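/- Let $p>3$ be a prime and let $m$ be an integer that is a primitive root modulo $p$, i.e. every integer coprime to $p$ is congruent modulo $p$ to $m^k$ for some integer $k\ge 1$. Consider the dynamical system $x_0=1$, $x_{k+1}=m x_k \bmod p\in\{0,\dots,p-1\}$ for $k\ge 0$, so that $x_k=m^k \bmod p$, and put $\tilde q=(p-1)/2$. For an integer $q\ge 0$, the value-list lifting of dimension $q+1$ is $z_k=(x_k,x_{k+1},\dots,x_{k+q})^\top$. A linear representation of dimension $q+1$ is a matrix $A\in\mathbb C^{(q+1)\times(q+1)}$ with $z_{k+1}=A z_k$ for all $k\ge 0$; it is a real companion representation if $A$ has ones on the superdiagonal, last row $(\alpha_0,\dots,\alpha_q)\in\mathbb R^{q+1}$, and zeros elsewhere (for $q=0$, $A=(\alpha_0)$). Then the smallest dimension $q+1$ for which a linear representation exists is $\tilde q+1$, and this is also the smallest dimension for which a real companion representation exists. Moreover, for all $k\ge 0$, $$x_{k+\tilde q}=p-x_k,\qquad x_{k+\tilde q+1}=x_k-x_{k+1}+x_{k+\tilde q},$$ and no shorter homogeneous linear recurrence with constant coefficients exists: for no integer $0\le d\le\tilde q$ are there $\alpha_0,\dots,\alpha_{d-1}\in\mathbb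 C$ such that $x_{k+d}=\sum_{j=0}^{d-1}\alpha_j x_{k+j}$ for all $k\ge 0$. -/

import Mathlib

/-- `m` is a primitive root modulo `p`: every integer coprime to `p` is congruent modulo `p` to
some power of `m` with positive exponent. -/
def IsPrimitiveRootMod (p : ℕ) (m : ℤ) : Prop :=
  ∀ c : ℤ, IsCoprime c (p : ℤ) → ∃ k : ℕ, 0 < k ∧ m ^ k ≡ c [ZMOD p]

/-- The transition map `x ↦ m x mod p` of the cryptosystem. -/
def dhMap (p : ℕ) (m : ℤ) (x : ℤ) : ℤ := (m * x) % p

/-- The trajectory `x₀ = 1`, `x_{k+1} = m x_k mod p`. -/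
def dhState (p : ℕ) (m : ℤ) (k : ℕ) : ℤ := (dhMap p m)^[k] 1

theorem dhState_eq (p : ℕ) (hp : 1 < p) (m : ℤ) (k : ℕ) : dhState p m k = m ^ k % p := by
  induction k with
  | zero =>
    have h : (1 : ℤ) % (p : ℤ) = 1 := Int.emod_eq_of_lt (by norm_num) (by exact_mod_cast hp)
    simp [dhState, h]
  | succ k ih =>
    unfold dhState at ih ⊢
    rw [Function.iterate_succ_apply', ih, dhMap, pow_succ', Int.mul_emod, Int.emod_emod,
      ← Int.mul_emod]

/-- The lifting `h = (h₀, …, h_q)` by the value-list observables: `h_j(x)` is the state that is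
reached from `x` after `j` steps, so that `h_j(x_k) = x_{k+j}`. Values are taken in `K`. -/
def valueListLift (K : Type*) [Field K] (p : ℕ) (m : ℤ) (q : ℕ) (x : ℤ) : Fin (q + 1) → K :=
  fun j => (((dhMap p m)^[(j : ℕ)] x : ℤ) : K)

/-- The lifted states `z_k = h(x_k)` follow the linear dynamics `z_{k+1} = A z_k` for all `k`. -/
def IsLinearRepresentation {K : Type*} [Field K] (p : ℕ) (m : ℤ) (q : ℕ)
    (A : Matrix (Fin (q + 1)) (Fin (q + 1)) K) : Prop :=
  ∀ k : ℕ, valueListLift K p m q (dhState p m (k + 1)) =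
    A.mulVec (valueListLift K p m q (dhState p m k))

/-- The companion matrix with ones on the superdiagonal and last row `(α₀, …, α_q)`. -/
def companionMatrix {K : Type*} [Field K] {q : ℕ} (α : Fin (q + 1) → K) :
    Matrix (Fin (q + 1)) (Fin (q + 1)) K :=
  fun i j => if (i : ℕ) = q then α j else if (j : ℕ) = (i : ℕ) + 1 then 1 else 0

/-! Write `n = (p-1)/2`. A generator satisfies `g ^ n = -1`, so `x_{k+n} = p - x_k`; eliminating `p`
between consecutive indices gives a recurrence of order `n + 1`, hence a companion representation.
Conversely, Cayley–Hamilton turns any representation into a recurrence of the same order, and every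
frequency with nonzero Fourier coefficient is a root of its monic characteristic polynomial
(`pow_eq_sum_of_recurrence`). It remains to find `n + 1` such frequencies. At `1` the coefficient is
a sum of positive residues. At `w` with `w ^ n = -1` it is the first moment `∑ a χ(a)` of the odd
character with `χ(g) = w⁻¹`. If this moment vanished, then `L(χ, 0) = 0`, and the functional
equation would give `L(χ⁻¹, 1) = 0`, contradicting Dirichlet's nonvanishing theorem. -/

/-! ### Abel sums and the value of an L-function at 0 -/

open Complex Filter Topology Asymptotics Set in
/-- The Abel sum `∑ Φ(n) e^{-nt}` of a periodic function, summed over residue classes. -/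
theorem ZMod.hasSum_mul_exp_neg {N : ℕ} [NeZero N] (Φ : ZMod N → ℂ) {t : ℝ} (ht : 0 < t) :
    HasSum (fun n : ℕ => Φ n * Real.exp (-(n : ℝ) * t))
      ((∑ j : ZMod N, Φ j * Real.exp (-(j.val : ℝ) * t)) * ((1 - Real.exp (-(N : ℝ) * t) : ℝ) : ℂ)⁻¹) := by
  have hexp : ∀ n : ℕ, Real.exp (-(n : ℝ) * t) = Real.exp (-t) ^ n := fun n => by
    rw [← Real.exp_nat_mul]; ring_nf
  have h1 : Real.exp (-t) < 1 := Real.exp_lt_one_iff.mpr (by linarith)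
  obtain ⟨C, hC⟩ : ∃ C, ∀ j, ‖Φ j‖ ≤ C := by
    obtain ⟨C, hC⟩ := (Set.finite_range fun j => ‖Φ j‖).bddAbove
    exact ⟨C, fun j => hC ⟨j, rfl⟩⟩
  have hs : Summable (fun n : ℕ => Φ n * Real.exp (-(n : ℝ) * t)) := by
    refine Summable.of_norm_bounded
      ((summable_geometric_of_lt_one (Real.exp_pos (-t)).le h1).mul_left C) fun n => ?_
    rw [norm_mul, hexp, Complex.norm_real, Real.norm_of_nonneg (by positivity)]
    gcongr
    exact hC _
  convert! hs.hasSum using 1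
  rw [Nat.sumByResidueClasses hs N, Finset.sum_mul]
  refine Finset.sum_congr rfl fun j _ => ?_
  have hN : Real.exp (-t) ^ N < 1 :=
    pow_lt_one₀ (Real.exp_pos _).le h1 (NeZero.ne N)
  have : ∀ k : ℕ, Φ ((j.val + N * k : ℕ) : ZMod N) * Real.exp (-((j.val + N * k : ℕ) : ℝ) * t) =
      Φ j * Real.exp (-(j.val : ℝ) * t) * ((Real.exp (-t) ^ N : ℝ) : ℂ) ^ k := fun k => by
    rw [hexp, hexp]
    push_cast
    simp only [ZMod.natCast_val, ZMod.cast_id', id_eq, CharP.cast_eq_zero, zero_mul, add_zero]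
    rw [pow_add, pow_mul, mul_assoc]
  simp_rw [this]
  rw [tsum_mul_left, tsum_geometric_of_norm_lt_one, hexp N]
  · push_cast; rfl
  · rwa [Complex.norm_real, Real.norm_of_nonneg (by positivity)]

-- The two vanishing moments cancel the constant and linear Taylor terms of the exponentials.
open Complex Filter Topology Asymptotics Set in
theorem ZMod.isBigO_sum_mul_exp_neg {N : ℕ} [NeZero N] (Φ : ZMod N → ℂ)
    (h0 : ∑ j, Φ j = 0) (h1 : ∑ j, (j.val : ℂ) * Φ j = 0) :
    (fun t : ℝ => ∑ j : ZMod N, Φ j * Real.exp (-(j.val : ℝ) * t)) =O[𝓝[>] 0] fun t => t ^ 2 := by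
  have key : (fun t : ℝ => ∑ j : ZMod N, Φ j * Real.exp (-(j.val : ℝ) * t)) =
      fun t : ℝ => ∑ j : ZMod N,
        Φ j * ((Real.exp (-(j.val : ℝ) * t) - 1 - (-(j.val : ℝ) * t) : ℝ) : ℂ) := by
    funext t
    have : ∑ j : ZMod N, Φ j * ((Real.exp (-(j.val : ℝ) * t) - 1 - (-(j.val : ℝ) * t) : ℝ) : ℂ) =
        ∑ j : ZMod N, Φ j * Real.exp (-(j.val : ℝ) * t) - ∑ j, Φ j
          + t * ∑ j, (j.val : ℂ) * Φ j := by
      rw [Finset.mul_sum, ← Finset.sum_sub_distrib, ← Finset.sum_add_distrib]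
      refine Finset.sum_congr rfl fun j _ => ?_
      push_cast
      ring
    rw [this, h0, h1]
    ring
  rw [key]
  refine IsBigO.fun_sum fun j _ => ?_
  refine IsBigO.const_mul_left ?_ _
  refine IsBigO.of_bound ((j.val : ℝ) ^ 2) ?_
  have hev : ∀ᶠ t : ℝ in 𝓝[>] 0, |-(j.val : ℝ) * t| ≤ 1 := by
    have : Tendsto (fun t : ℝ => |-(j.val : ℝ) * t|) (𝓝[>] 0) (𝓝 0) := by
      have : Continuous (fun t : ℝ => |-(j.val : ℝ) * t|) := by fun_prop
      simpa using (this.tendsto 0).mono_left nhdsWithin_le_nhds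
    exact this.eventually_le_const one_pos
  filter_upwards [hev] with t ht
  rw [Complex.norm_real, Real.norm_eq_abs]
  refine (Real.abs_exp_sub_one_sub_id_le ht).trans_eq ?_
  rw [Real.norm_of_nonneg (by positivity)]
  ring

open Complex Filter Topology Asymptotics Set in
/-- If `Φ` vanishes at `0` and both its sum and its first moment vanish, then its `L`-function
vanishes at `0`. -/
theorem ZMod.LFunction_apply_zero_eq_zero {N : ℕ} [NeZero N] (Φ : ZMod N → ℂ) (hΦ : Φ 0 = 0)
    (h0 : ∑ j, Φ j = 0) (h1 : ∑ j, (j.val : ℂ) * Φ j = 0) : ZMod.LFunction Φ 0 = 0 := by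
  set G : ℝ → ℂ := fun t => ∑ j : ZMod N, Φ j * Real.exp (-(j.val : ℝ) * t) with hG
  set D : ℝ → ℂ := fun t => ((1 - Real.exp (-(N : ℝ) * t) : ℝ) : ℂ)⁻¹ with hD
  set F : ℝ → ℂ := fun t => G t * D t with hF
  have hN : 0 < (N : ℝ) := Nat.cast_pos.mpr (NeZero.pos N)
  have hden : ∀ t : ℝ, 0 < t → 0 < 1 - Real.exp (-(N : ℝ) * t) := fun t ht => by
    have : Real.exp (-(N : ℝ) * t) < 1 := Real.exp_lt_one_iff.mpr (by nlinarith)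
    linarith
  have hloc : MeasureTheory.LocallyIntegrableOn F (Ioi 0) := by
    refine ContinuousOn.locallyIntegrableOn ?_ measurableSet_Ioi
    refine ContinuousOn.mul (Continuous.continuousOn (by fun_prop)) (ContinuousOn.inv₀
      (Continuous.continuousOn (by fun_prop)) fun t ht => ?_)
    exact_mod_cast (hden t ht).ne'
  have htop : F =O[atTop] fun t => Real.exp (-1 * t) := by
    have hD' : D =O[atTop] fun _ => (1 : ℝ) := by
      have : Tendsto D atTop (𝓝 (((1 - 0 : ℝ) : ℂ)⁻¹)) := by
        refine Tendsto.inv₀ ?_ (by simp)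
        refine (Complex.continuous_ofReal.tendsto _).comp (tendsto_const_nhds.sub ?_)
        refine Real.tendsto_exp_atBot.comp ?_
        exact tendsto_id.const_mul_atTop_of_neg (by linarith)
      exact this.isBigO_one ℝ
    have hG' : G =O[atTop] fun t => Real.exp (-1 * t) := by
      refine IsBigO.fun_sum fun j _ => ?_
      -- The term `j = 0` does not decay; `Φ 0 = 0` removes it.
      rcases eq_or_ne j 0 with rfl | hj
      · simpa [hΦ] using isBigO_zero _ _
      refine IsBigO.const_mul_left (IsBigO.of_bound 1 ?_) _
      filter_upwards [eventually_ge_atTop 0] with t ht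
      rw [Complex.norm_real, Real.norm_of_nonneg (Real.exp_pos _).le,
        Real.norm_of_nonneg (Real.exp_pos _).le, one_mul]
      refine Real.exp_le_exp.mpr ?_
      have : (1 : ℝ) ≤ j.val := by
        exact_mod_cast Nat.one_le_iff_ne_zero.mpr ((ZMod.val_ne_zero j).mpr hj)
      nlinarith
    simpa using hG'.mul hD'
  -- `G = O(t²)` and `D = O(1/t)`, so `F = O(t)` and its Mellin transform is holomorphic for `Re s >
  -- -1`, a region containing `0`.
  have hbot : F =O[𝓝[>] 0] fun t : ℝ => t ^ (-(-1 : ℝ)) := by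
    have hD' : D =O[𝓝[>] 0] fun t : ℝ => t⁻¹ := by
      -- The constant is `2`, from `1 - e^{-Nt} ≥ t/2` for `0 < t < 1/N`.
      refine IsBigO.of_bound (1 + N / N) ?_
      filter_upwards [Ioo_mem_nhdsGT (one_div_pos.mpr hN)] with t ht
      have hNt : N * t < 1 := by
        have := ht.2
        rwa [lt_div_iff₀ hN, mul_comm] at this
      have hNt' : 0 < N * t := mul_pos hN ht.1
      have hN1 : (1 : ℝ) ≤ N := by exact_mod_cast NeZero.pos N
      have hb : t / 2 ≤ 1 - Real.exp (-(N : ℝ) * t) := by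
        have h2 := Real.add_one_le_exp (N * t)
        have h3 : Real.exp (-(N : ℝ) * t) * Real.exp (N * t) = 1 := by
          rw [← Real.exp_add]; simp
        have h4 := Real.exp_pos (-(N : ℝ) * t)
        have h5 := ht.1
        have h6 : Real.exp (-(N : ℝ) * t) * (N * t + 1) ≤ 1 := by
          exact (mul_le_mul_of_nonneg_left h2 h4.le).trans_eq h3
        have h7 : t ≤ N * t := by nlinarith
        nlinarith
      rw [hD]
      simp only [norm_inv, Complex.norm_real]
      rw [Real.norm_of_nonneg (hden t ht.1).le, Real.norm_of_nonneg ht.1.le, div_self hN.ne']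
      have h8 : (0 : ℝ) < t / 2 := by have := ht.1; linarith
      calc _ ≤ (t / 2)⁻¹ := inv_anti₀ h8 hb
        _ = _ := by rw [inv_div, div_eq_mul_inv]; norm_num
    refine ((ZMod.isBigO_sum_mul_exp_neg Φ h0 h1).mul hD').congr' (.of_forall fun _ => rfl) ?_
    filter_upwards [self_mem_nhdsWithin] with t ht
    have : t ≠ 0 := (mem_Ioi.mp ht).ne'
    simp only [neg_neg, Real.rpow_one]
    field_simp
  have hmellin : ∀ s : ℂ, -1 < s.re → DifferentiableAt ℂ (mellin F) s := fun s hs =>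
    mellin_differentiableAt_of_isBigO_rpow_exp one_pos hloc htop hbot hs
  have hsum : ∀ s : ℂ, 1 < s.re → ZMod.LFunction Φ s = (Gamma s)⁻¹ * mellin F s := fun s hs => by
    have hs0 : 0 < s.re := by linarith
    have := hasSum_mellin (a := fun n : ℕ => Φ n) (p := fun n : ℕ => (n : ℝ)) (F := F) (s := s)
      (fun n => by
        rcases Nat.eq_zero_or_pos n with rfl | hn
        · left; simpa using hΦ
        · right; exact_mod_cast hn) hs0
      (fun t ht => ZMod.hasSum_mul_exp_neg Φ ht)
      (by
        have := (ZMod.LSeriesSummable_of_one_lt_re Φ hs).norm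
        refine this.congr fun n => ?_
        rw [LSeries.norm_term_eq]
        rcases eq_or_ne n 0 with rfl | hn
        · simp [hΦ]
        · simp [hn])
    rw [← this.tsum_eq, ZMod.LFunction_eq_LSeries _ hs, LSeries, ← tsum_mul_left]
    refine tsum_congr fun n => ?_
    rw [LSeries.term_of_ne_zero' (by rintro rfl; simp at hs0), ← mul_div_assoc, ← mul_assoc,
      inv_mul_cancel₀ (Gamma_ne_zero_of_re_pos hs0), one_mul, Complex.ofReal_natCast]
  set U : Set ℂ := {s | -1 < s.re} with hU
  have hUo : IsOpen U := isOpen_lt continuous_const Complex.continuous_re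
  have hL : AnalyticOnNhd ℂ (ZMod.LFunction Φ) U :=
    (ZMod.differentiable_LFunction_of_sum_zero h0).differentiableOn.analyticOnNhd hUo
  have hR : AnalyticOnNhd ℂ (fun s => (Gamma s)⁻¹ * mellin F s) U :=
    DifferentiableOn.analyticOnNhd (fun s hs =>
      ((differentiable_one_div_Gamma s).mul (hmellin s hs)).differentiableWithinAt) hUo
  have h2U : (2 : ℂ) ∈ U := by simp [hU]; norm_num
  have hev : ZMod.LFunction Φ =ᶠ[𝓝 2] fun s => (Gamma s)⁻¹ * mellin F s := by
    have : {s : ℂ | 1 < s.re} ∈ 𝓝 (2 : ℂ) :=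
      (isOpen_lt continuous_const Complex.continuous_re).mem_nhds (by simp)
    filter_upwards [this] with s hs using hsum s hs
  have := hL.eqOn_of_preconnected_of_eventuallyEq hR
    (convex_halfSpace_re_gt (-1)).isPreconnected h2U hev (show (0 : ℂ) ∈ U by simp [hU])
  -- The entire function `1/Γ` vanishes at `0`; this agrees with the conventions `Gamma 0 = 0` and
  -- `0⁻¹ = 0`.
  simpa [Gamma_zero] using this

/-! ### First moments of odd Dirichlet characters -/

/-- The value at `0` of the `L`-function of an odd primitive character does not vanish. -/
theorem DirichletCharacter.LFunction_apply_zero_ne_zero {N : ℕ} [NeZero N]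
    {χ : DirichletCharacter ℂ N} (hχ : χ.Odd) (hp : χ⁻¹.IsPrimitive) (h1 : χ ≠ 1) :
    DirichletCharacter.LFunction χ 0 ≠ 0 := by
  have hL : DirichletCharacter.LFunction χ⁻¹ 1 ≠ 0 :=
    DirichletCharacter.LFunction_apply_one_ne_zero (inv_ne_one.mpr h1)
  have hN : N ≠ 1 := by
    rintro rfl
    exact h1 (Subsingleton.elim _ _)
  rw [DirichletCharacter.LFunction_eq_completed_div_gammaFactor _ _ (.inl one_ne_zero)] at hL
  rw [DirichletCharacter.LFunction_eq_completed_div_gammaFactor _ _ (.inr hN), hχ.gammaFactor_def]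
  -- Oddness makes the Gamma factor at `0` equal to `Γ_ℝ(1)`, so there is no trivial zero, and the
  -- functional equation links `0` to `1`.
  have hfe := hp.completedLFunction_one_sub 0
  rw [sub_zero, inv_inv] at hfe
  refine div_ne_zero (fun h => hL ?_) (Complex.Gammaℝ_ne_zero_of_re_pos (by simp))
  rw [hfe, h]
  simp

theorem DirichletCharacter.isPrimitive_of_prime {p : ℕ} (hp : p.Prime) {R : Type*}
    [CommMonoidWithZero R] {χ : DirichletCharacter R p} (h : χ ≠ 1) : χ.IsPrimitive := by
  rcases (Nat.dvd_prime hp).mp χ.conductor_dvd_level with h1 | h1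
  · have : NeZero p := ⟨hp.ne_zero⟩
    exact absurd (DirichletCharacter.eq_one_iff_conductor_eq_one.mpr h1) h
  · exact h1

/-- The first moment of an odd Dirichlet character of prime modulus does not vanish. -/
theorem DirichletCharacter.sum_val_mul_ne_zero {p : ℕ} [Fact p.Prime]
    {χ : DirichletCharacter ℂ p} (hχ : χ.Odd) : ∑ a : ZMod p, (a.val : ℂ) * χ a ≠ 0 := by
  intro h
  have h1 : χ ≠ 1 := by
    rintro rfl
    have h2 : (1 : DirichletCharacter ℂ p) (-1) = -1 := hχ
    rw [MulChar.one_apply isUnit_one.neg] at h2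
    norm_num at h2
  have hp := Fact.out (p := p.Prime)
  exact DirichletCharacter.LFunction_apply_zero_ne_zero hχ
    (DirichletCharacter.isPrimitive_of_prime hp (inv_ne_one.mpr h1)) h1
    (ZMod.LFunction_apply_zero_eq_zero _ (MulChar.map_nonunit χ not_isUnit_zero)
      (MulChar.sum_eq_zero_of_ne_one h1) h)

/-! ### Frequencies of periodic sequences and linear recurrences -/

theorem Finset.sum_range_add_of_periodic {M : Type*} [AddCancelCommMonoid M] {f : ℕ → M} {n : ℕ}
    (hf : Function.Periodic f n) (j : ℕ) :
    ∑ k ∈ Finset.range n, f (k + j) = ∑ k ∈ Finset.range n, f k := by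
  induction j with
  | zero => rfl
  | succ j ih =>
    rw [← ih]
    have h1 := Finset.sum_range_succ (fun k => f (k + j)) n
    rw [Finset.sum_range_succ'] at h1
    simp only [zero_add] at h1
    rw [show f (n + j) = f j by rw [add_comm]; exact hf j] at h1
    rw [← add_right_cancel h1]
    exact Finset.sum_congr rfl fun k _ => by ring_nf

/-- A frequency that occurs in the discrete Fourier expansion of a periodic sequence is a
characteristic root of every linear recurrence which the sequence satisfies. -/
theorem pow_eq_sum_of_recurrence {K : Type*} [Field K] {x : ℕ → K} {n d : ℕ}
    (hx : Function.Periodic x n) {α : Fin d → K}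
    (hrec : ∀ k, x (k + d) = ∑ j : Fin d, α j * x (k + j)) {w : K} (hw0 : w ≠ 0) (hw : w ^ n = 1)
    (hS : ∑ k ∈ Finset.range n, x k * w⁻¹ ^ k ≠ 0) :
    w ^ d = ∑ j : Fin d, α j * w ^ (j : ℕ) := by
  have hper : Function.Periodic (fun k => x k * w⁻¹ ^ k) n := fun k => by
    simp only [hx k, pow_add, inv_pow, hw, inv_one, mul_one]
  -- A shift by `j` multiplies the Fourier coefficient by `w ^ j`; applied to the recurrence, this
  -- leaves a nonzero common factor to cancel.
  have hshift : ∀ j, ∑ k ∈ Finset.range n, x (k + j) * w⁻¹ ^ k =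
      w ^ j * ∑ k ∈ Finset.range n, x k * w⁻¹ ^ k := fun j => by
    rw [← Finset.sum_range_add_of_periodic hper j, Finset.mul_sum]
    refine Finset.sum_congr rfl fun k _ => ?_
    rw [pow_add, inv_pow w j]
    field_simp
  refine mul_right_cancel₀ hS ?_
  rw [← hshift d, Finset.sum_mul]
  simp_rw [mul_assoc, ← hshift, hrec, Finset.mul_sum, Finset.sum_mul]
  rw [Finset.sum_comm]
  simp_rw [mul_assoc]

/-- A monic polynomial of degree `d` has at most `d` roots. -/
theorem Finset.card_le_of_pow_eq_sum {K : Type*} [Field K] {d : ℕ} (α : Fin d → K) (T : Finset K)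
    (hT : ∀ w ∈ T, w ^ d = ∑ j : Fin d, α j * w ^ (j : ℕ)) : T.card ≤ d := by
  classical
  open Polynomial in
  set Q : K[X] := ∑ j : Fin d, C (α j) * X ^ (j : ℕ) with hQ
  have hQd : Q.degree < d := Polynomial.degree_sum_fin_lt α
  have hmon := Polynomial.monic_X_pow_sub hQd
  have hdeg : (Polynomial.X ^ d - Q).natDegree = d :=
    Polynomial.natDegree_eq_of_degree_eq_some (by
      rw [Polynomial.degree_sub_eq_left_of_degree_lt] <;> simp [hQd])
  calc T.card ≤ (Polynomial.X ^ d - Q).roots.toFinset.card := by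
        refine Finset.card_le_card fun w hw => ?_
        rw [Multiset.mem_toFinset, Polynomial.mem_roots hmon.ne_zero, Polynomial.IsRoot.def]
        simp [hQ, Polynomial.eval_finsetSum, hT w hw]
    _ ≤ _ := (Multiset.toFinset_card_le _).trans ((Polynomial.card_roots' _).trans hdeg.le)

/-- These are the odd powers of a primitive `2q`-th root of unity. -/
theorem Complex.exists_finset_pow_eq_neg_one {q : ℕ} (hq : 0 < q) :
    ∃ T : Finset ℂ, T.card = q ∧ ∀ w ∈ T, w ^ q = -1 := by
  have hζ := Complex.isPrimitiveRoot_exp (2 * q) (by lia)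
  set ζ := Complex.exp (2 * Real.pi * Complex.I / (2 * q : ℕ))
  have hneg : ζ ^ q = -1 := by
    have h1 : (ζ ^ q) ^ 2 = 1 := by rw [← pow_mul, mul_comm, hζ.pow_eq_one]
    exact (mul_self_eq_one_iff.mp (by rw [← sq, h1])).resolve_left
      (hζ.pow_ne_one_of_pos_of_lt hq.ne' (by lia))
  refine ⟨(Finset.range q).image fun j => ζ ^ (2 * j + 1), ?_, ?_⟩
  · rw [Finset.card_image_of_injOn, Finset.card_range]
    intro i hi j hj hij
    have hi := Finset.mem_range.mp hi
    have hj := Finset.mem_range.mp hj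
    have := hζ.pow_inj (by lia) (by lia) hij
    lia
  · intro w hw
    obtain ⟨j, -, rfl⟩ := Finset.mem_image.mp hw
    rw [← pow_mul, mul_comm, pow_mul, hneg, Odd.neg_one_pow ⟨j, rfl⟩]

/-! ### The trajectory as powers of a generator -/

section PrimitiveRoot

variable {p : ℕ} {m : ℤ}

theorem dhMap_iterate_dhState (p : ℕ) (m : ℤ) (k j : ℕ) :
    (dhMap p m)^[j] (dhState p m k) = dhState p m (k + j) := by
  rw [dhState, ← Function.iterate_add_apply, add_comm, dhState]

theorem valueListLift_dhState (K : Type*) [Field K] (p : ℕ) (m : ℤ) (q k : ℕ) :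
    valueListLift K p m q (dhState p m k) =
      fun j : Fin (q + 1) => (dhState p m (k + (j : ℕ)) : K) := by
  funext j
  rw [valueListLift, dhMap_iterate_dhState]

theorem IsPrimitiveRootMod.exists_unit [Fact p.Prime] (hm : IsPrimitiveRootMod p m) :
    ∃ g : (ZMod p)ˣ, (g : ZMod p) = m ∧ ∀ x, x ∈ Subgroup.zpowers g := by
  have hm' : IsUnit (m : ZMod p) := by
    -- A positive exponent is essential: `m ^ 0 = 1` would not make `m` a unit.
    obtain ⟨k, hk, h⟩ := hm 1 isCoprime_one_left
    have h' := (ZMod.intCast_eq_intCast_iff _ _ _).mpr h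
    push_cast at h'
    exact IsUnit.of_pow_eq_one h' hk.ne'
  obtain ⟨g, hg⟩ := hm'
  refine ⟨g, hg, fun x => ?_⟩
  obtain ⟨k, -, h⟩ := hm ((x : ZMod p).val : ℤ)
    (Nat.isCoprime_iff_coprime.mpr (ZMod.val_coe_unit_coprime x))
  have h' := (ZMod.intCast_eq_intCast_iff _ _ _).mpr h
  push_cast at h'
  rw [ZMod.natCast_zmod_val, ← hg] at h'
  exact Subgroup.mem_zpowers_iff.mpr ⟨k, Units.ext (by simpa using h')⟩

theorem dhState_eq_val [hp : Fact p.Prime] {g : (ZMod p)ˣ} (hg : (g : ZMod p) = m) (k : ℕ) :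
    dhState p m k = (((g ^ k : (ZMod p)ˣ) : ZMod p).val : ℤ) := by
  rw [dhState_eq p hp.out.one_lt, ← ZMod.val_intCast, Units.val_pow_eq_pow_val, hg]
  push_cast
  rfl

variable [Fact p.Prime] {g : (ZMod p)ˣ}

theorem orderOf_eq_of_forall_mem_zpowers (hgen : ∀ x, x ∈ Subgroup.zpowers g) :
    orderOf g = p - 1 := by
  rw [orderOf_eq_card_of_forall_mem_zpowers hgen, Nat.card_eq_fintype_card, ZMod.card_units]

theorem pow_half_eq_neg_one (hgen : ∀ x, x ∈ Subgroup.zpowers g) (hp : 3 < p) :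
    g ^ ((p - 1) / 2) = -1 := by
  have hodd := (Fact.out (p := p.Prime)).eq_two_or_odd'.resolve_left (by lia)
  obtain ⟨r, hr⟩ := hodd
  have hord := orderOf_eq_of_forall_mem_zpowers hgen
  have hne : g ^ ((p - 1) / 2) ≠ 1 := pow_ne_one_of_lt_orderOf (by lia) (by lia)
  have hsq : (g ^ ((p - 1) / 2)) ^ 2 = 1 := by
    rw [← pow_mul, show (p - 1) / 2 * 2 = orderOf g by lia, pow_orderOf_eq_one]
  refine Units.ext ?_
  have h1 : ((g ^ ((p - 1) / 2) : (ZMod p)ˣ) : ZMod p) ^ 2 = 1 := by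
    rw [← Units.val_pow_eq_pow_val, hsq, Units.val_one]
  exact (mul_self_eq_one_iff.mp (by rw [← sq, h1])).resolve_left
    fun h => hne (Units.ext h)

theorem dhState_add_half (hg : (g : ZMod p) = m) (hgen : ∀ x, x ∈ Subgroup.zpowers g)
    (hp : 3 < p) (k : ℕ) :
    dhState p m (k + (p - 1) / 2) = (p : ℤ) - dhState p m k := by
  rw [dhState_eq_val hg, dhState_eq_val hg, pow_add, pow_half_eq_neg_one hgen hp, mul_neg, mul_one,
    Units.val_neg, ZMod.neg_val, if_neg (Units.ne_zero _), Nat.cast_sub (ZMod.val_lt _).le]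

theorem dhState_periodic (hg : (g : ZMod p) = m) (hgen : ∀ x, x ∈ Subgroup.zpowers g) :
    Function.Periodic (dhState p m) (p - 1) := fun k => by
  rw [dhState_eq_val hg, dhState_eq_val hg, pow_add, ← orderOf_eq_of_forall_mem_zpowers hgen,
    pow_orderOf_eq_one, mul_one]

/-- The discrete Fourier coefficients of the trajectory at the `(p-1)/2`-th roots of `-1` do not
vanish. -/
theorem sum_dhState_mul_pow_ne_zero (hg : (g : ZMod p) = m) (hgen : ∀ x, x ∈ Subgroup.zpowers g)
    (hp : 3 < p) {w : ℂ} (hw : w ^ ((p - 1) / 2) = -1) :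
    ∑ k ∈ Finset.range (p - 1), (dhState p m k : ℂ) * w ^ k ≠ 0 := by
  have hw0 : w ≠ 0 := by
    rintro rfl
    rw [zero_pow (by lia)] at hw
    norm_num at hw
  obtain ⟨r, hr⟩ := (Fact.out (p := p.Prime)).eq_two_or_odd'.resolve_left (by lia)
  have hroot : Units.mk0 w hw0 ∈ rootsOfUnity (Fintype.card (ZMod p)ˣ) ℂ := by
    rw [mem_rootsOfUnity, ZMod.card_units]
    refine Units.ext ?_
    rw [Units.val_pow_eq_pow_val, Units.val_mk0, show p - 1 = (p - 1) / 2 * 2 by lia, pow_mul, hw]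
    norm_num
  -- The character sending `g` to `w` is odd because `g` and `w` both have `(p-1)/2`-th power `-1`;
  -- substituting `a = g ^ k` turns its first moment into the given sum.
  set χ : DirichletCharacter ℂ p := MulChar.ofRootOfUnity hroot hgen
  have hχg : χ g = w := MulChar.ofRootOfUnity_spec hroot hgen
  have hχpow : ∀ k : ℕ, χ ((g ^ k : (ZMod p)ˣ) : ZMod p) = w ^ k := fun k => by
    rw [Units.val_pow_eq_pow_val, map_pow, hχg]
  have hodd : χ.Odd := by
    have := hχpow ((p - 1) / 2)
    rw [pow_half_eq_neg_one hgen hp, hw, Units.val_neg, Units.val_one] at this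
    exact this
  convert! DirichletCharacter.sum_val_mul_ne_zero hodd using 1
  rw [← Fintype.sum_of_injective (fun u : (ZMod p)ˣ => (u : ZMod p)) Units.val_injective
    (fun u => (((u : ZMod p).val : ℂ)) * χ u) _ (fun a ha => ?_) (fun u => rfl)]
  · rw [← IsCyclic.image_range_orderOf hgen, Finset.sum_image,
      orderOf_eq_of_forall_mem_zpowers hgen]
    · refine Finset.sum_congr rfl fun k _ => ?_
      rw [hχpow, dhState_eq_val hg]
      push_cast
      rfl
    · intro i hi j hj hij
      exact pow_injOn_Iio_orderOf (by simpa using hi) (by simpa using hj) hij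
  · rw [MulChar.map_nonunit χ fun hu => ha ⟨hu.unit, rfl⟩, mul_zero]

theorem not_recurrence_of_lt (hg : (g : ZMod p) = m) (hgen : ∀ x, x ∈ Subgroup.zpowers g)
    (hp : 3 < p) {d : ℕ} (hd : d < (p - 1) / 2 + 1) :
    ¬ ∃ α : Fin d → ℂ, ∀ k : ℕ,
      (dhState p m (k + d) : ℂ) = ∑ j : Fin d, α j * (dhState p m (k + (j : ℕ)) : ℂ) := by
  rintro ⟨α, hα⟩
  have hper : Function.Periodic (fun k => (dhState p m k : ℂ)) (p - 1) :=
    (dhState_periodic hg hgen).comp _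
  obtain ⟨r, hr⟩ := (Fact.out (p := p.Prime)).eq_two_or_odd'.resolve_left (by lia)
  obtain ⟨T, hTc, hT⟩ := Complex.exists_finset_pow_eq_neg_one (q := (p - 1) / 2) (by lia)
  have h1T : (1 : ℂ) ∉ T := fun h => by
    have := hT 1 h
    norm_num at this
  have hcard := Finset.card_le_of_pow_eq_sum α (insert 1 T) fun w hw => ?_
  · rw [Finset.card_insert_of_notMem h1T, hTc] at hcard
    lia
  rcases Finset.mem_insert.mp hw with rfl | hw
  · refine pow_eq_sum_of_recurrence hper hα one_ne_zero (one_pow _) ?_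
    simp only [inv_one, one_pow, mul_one]
    have hpos : ∀ k, 0 < dhState p m k := fun k => by
      rw [dhState_eq_val hg]
      exact_mod_cast Nat.pos_of_ne_zero ((ZMod.val_ne_zero _).mpr (Units.ne_zero _))
    exact_mod_cast (Finset.sum_pos (fun k _ => hpos k) ⟨0, by simp; lia⟩).ne'
  · have hwq := hT w hw
    have hw0 : w ≠ 0 := by
      rintro rfl
      rw [zero_pow (by lia)] at hwq
      norm_num at hwq
    refine pow_eq_sum_of_recurrence hper hα hw0 ?_
      (sum_dhState_mul_pow_ne_zero hg hgen hp (by rw [inv_pow, hwq]; norm_num))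
    rw [show p - 1 = (p - 1) / 2 * 2 by lia, pow_mul, hwq]
    norm_num

end PrimitiveRoot

/-! ### Linear representations and minimal dimension -/

/-- By Cayley–Hamilton, a linear representation yields a linear recurrence whose order is its
dimension. -/
theorem IsLinearRepresentation.exists_recurrence {K : Type*} [Field K] {p : ℕ} {m : ℤ} {q : ℕ}
    {A : Matrix (Fin (q + 1)) (Fin (q + 1)) K} (hA : IsLinearRepresentation p m q A) :
    ∃ α : Fin (q + 1) → K, ∀ k : ℕ, (dhState p m (k + (q + 1)) : K) =
      ∑ j : Fin (q + 1), α j * (dhState p m (k + (j : ℕ)) : K) := by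
  have hpow : ∀ j k : ℕ, (A ^ j).mulVec (valueListLift K p m q (dhState p m k)) =
      valueListLift K p m q (dhState p m (k + j)) := fun j => by
    induction j with
    | zero => intro k; simp
    | succ j ih =>
      intro k
      rw [pow_succ, ← Matrix.mulVec_mulVec, ← hA, ih]
      congr 2
      lia
  have hdeg : A.charpoly.natDegree = q + 1 := by simp [Matrix.charpoly_natDegree_eq_dim]
  refine ⟨fun j => -A.charpoly.coeff j, fun k => ?_⟩
  -- Coordinate `0` of `A ^ j z_k` is `x_{k+j}`, so this coordinate of the Cayley–Hamilton identity
  -- is a scalar recurrence.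
  have h := congrArg (fun M => M.mulVec (valueListLift K p m q (dhState p m k)) 0)
    (Matrix.aeval_self_charpoly A)
  simp only [Polynomial.aeval_eq_sum_range, hdeg, Matrix.sum_mulVec, Matrix.smul_mulVec, hpow,
    Matrix.zero_mulVec, Finset.sum_apply, Pi.smul_apply, Pi.zero_apply, smul_eq_mul] at h
  simp only [valueListLift_dhState, Fin.val_zero, add_zero] at h
  have hlead : A.charpoly.coeff (q + 1) = 1 := by
    rw [← A.charpoly_monic.coeff_natDegree, hdeg]
  rw [Finset.sum_range_succ, hlead, one_mul, Finset.sum_range] at h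
  simp only [neg_mul, Finset.sum_neg_distrib]
  linear_combination h

theorem isLinearRepresentation_companionMatrix {K : Type*} [Field K] {p : ℕ} {m : ℤ} {q : ℕ}
    {α : Fin (q + 1) → K} (hα : ∀ k : ℕ, (dhState p m (k + (q + 1)) : K) =
      ∑ j : Fin (q + 1), α j * (dhState p m (k + (j : ℕ)) : K)) :
    IsLinearRepresentation p m q (companionMatrix α) := fun k => by
  rw [valueListLift_dhState, valueListLift_dhState]
  funext i
  simp only [Matrix.mulVec, dotProduct, companionMatrix]
  by_cases hi : (i : ℕ) = q
  · simp only [hi, if_true, ← hα k]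
    congr 2
    lia
  · have hlt : (i : ℕ) + 1 < q + 1 := by lia
    rw [Finset.sum_eq_single ⟨i + 1, hlt⟩]
    · simp only [hi, if_false, if_true, one_mul]
      congr 2
      lia
    · intro j _ hj
      rw [if_neg hi, if_neg fun h => hj (Fin.ext h), zero_mul]
    · simp

/-- The characteristic polynomial is `X^(q+1) - X^q + X - 1 = (X - 1)(X^q + 1)`; for `q = (p-1)/2`
its complex roots are exactly the frequencies used in the lower bound. -/
theorem exists_companion_recurrence (K : Type*) [Field K] {p : ℕ} {m : ℤ} {q : ℕ} (hq : 2 ≤ q)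
    (h : ∀ k : ℕ, dhState p m (k + q + 1) =
      dhState p m k - dhState p m (k + 1) + dhState p m (k + q)) :
    ∃ α : Fin (q + 1) → K, ∀ k : ℕ, (dhState p m (k + (q + 1)) : K) =
      ∑ j : Fin (q + 1), α j * (dhState p m (k + (j : ℕ)) : K) := by
  refine ⟨Pi.single 0 1 - Pi.single ⟨1, by lia⟩ 1 + Pi.single (Fin.last q) 1, fun k => ?_⟩
  simp only [Pi.add_apply, Pi.sub_apply, add_mul, sub_mul, Finset.sum_add_distrib,
    Finset.sum_sub_distrib, Pi.single_apply, ite_mul, one_mul, zero_mul, Finset.sum_ite_eq',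
    Finset.mem_univ, if_true, Fin.val_zero, Fin.val_last, add_zero]
  rw [← add_assoc, h k]
  push_cast
  rfl

theorem mainTheorem2 (p : ℕ) (hp : p.Prime) (hp3 : 3 < p) (m : ℤ)
    (hm : IsPrimitiveRootMod p m) :
    -- minimal lifting dimension, arbitrary complex system matrix
    IsLeast {d : ℕ | ∃ q : ℕ, d = q + 1 ∧
        ∃ A : Matrix (Fin (q + 1)) (Fin (q + 1)) ℂ, IsLinearRepresentation p m q A}
      ((p - 1) / 2 + 1) ∧
    -- minimal lifting dimension, real companion matrix
    IsLeast {d : ℕ | ∃ q : ℕ, d = q + 1 ∧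
        ∃ α : Fin (q + 1) → ℝ, IsLinearRepresentation p m q (companionMatrix α)}
      ((p - 1) / 2 + 1) ∧
    (∀ k : ℕ, dhState p m (k + (p - 1) / 2) = (p : ℤ) - dhState p m k) ∧
    (∀ k : ℕ, dhState p m (k + (p - 1) / 2 + 1) =
      dhState p m k - dhState p m (k + 1) + dhState p m (k + (p - 1) / 2)) ∧
    -- no shorter linear recurrence
    (∀ d : ℕ, d < (p - 1) / 2 + 1 → ¬ ∃ α : Fin d → ℂ, ∀ k : ℕ,
      (dhState p m (k + d) : ℂ) = ∑ j : Fin d, α j * (dhState p m (k + (j : ℕ)) : ℂ)) := by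
  have : Fact p.Prime := ⟨hp⟩
  obtain ⟨g, hg, hgen⟩ := hm.exists_unit
  have hhalf := dhState_add_half hg hgen hp3
  have hmin : ∀ d : ℕ, d < (p - 1) / 2 + 1 → _ := fun d hd => not_recurrence_of_lt hg hgen hp3 hd
  have hq : 2 ≤ (p - 1) / 2 := by
    obtain ⟨r, hr⟩ := hp.eq_two_or_odd'.resolve_left (by lia)
    lia
  have hrec : ∀ k : ℕ, dhState p m (k + (p - 1) / 2 + 1) =
      dhState p m k - dhState p m (k + 1) + dhState p m (k + (p - 1) / 2) := fun k => by
    -- Both `x_k + x_{k+n}` and `x_{k+1} + x_{k+1+n}` equal `p`, where `n = (p-1)/2`.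
    rw [add_right_comm, hhalf, hhalf]
    ring
  refine ⟨⟨?_, ?_⟩, ⟨?_, ?_⟩, hhalf, hrec, hmin⟩
  · obtain ⟨α, hα⟩ := exists_companion_recurrence ℂ hq hrec
    exact ⟨_, rfl, _, isLinearRepresentation_companionMatrix hα⟩
  · rintro d ⟨q, rfl, A, hA⟩
    by_contra! hlt
    exact hmin _ hlt hA.exists_recurrence
  · obtain ⟨α, hα⟩ := exists_companion_recurrence ℝ hq hrec
    exact ⟨_, rfl, _, isLinearRepresentation_companionMatrix hα⟩
  · rintro d ⟨q, rfl, β, hβ⟩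
    by_contra! hlt
    obtain ⟨α, hα⟩ := hβ.exists_recurrence
    exact hmin _ hlt ⟨fun j => (α j : ℂ), fun k => by simpa using congrArg Complex.ofReal (hα k)⟩
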